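/- Let $A$ be a countable set with the discrete topology, and let $A^{\mathbb Z}$ carry the product $\sigma$-algebra. A probability kernel is a function $g:A\times A^{\{\dots,-2,-1\}}\to[0,1]$ with $\sum_{a\in A}g(a|x)=1$ for every past $x=(\dots,x_{-2},x_{-1})$. For $j\ge 0$ put $$\mathrm{Var}_j(g)=\sup\Big\{\tfrac12\sum_{a\in A}|g(a|z)-g(a|z')| : z_k=z'_k \text{ for all } -j\le k\le -1\Big\},\qquad \Gamma(g)=\prod_{j=0}^\infty\big(1-\mathrm{Var}_j(g)\big)$$ (so there is no constraint on the pasts $z,z'$ when $j=0$). A probability measure $\mu$ on $A^{\mathbb Z}$ is compatible with $g$ if, for all $n\in\mathbb Z$ and $a\in A$, $\mu(\omega_n=a\mid (\omega_i)_{i\le n-1})=g(a|\dots,\omega_{n-2},\omega_{n-1})$ for $\mu$-a.e. $\omega$. For $n\ge0$ and $f:A^{n+1}\to\mathbb R$, let $$\delta_j(f)=\sup\big\{|f(\omega_0^{j-1}a\,\omega_{j+1}^n)-f(\omega_0^{j-1}b\,\omega_{j+1}^n)| : a,b\in A,\ \omega\in A^{n+1}\big\},\qquad \|\delta(f)\|_2^2=\sum_{j=0}^n\delta_j(f)^2,$$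 and let $\mathcal L$ be the set of all such $f$ (over all $n\ge 0$) with $\delta_j(f)<\infty$ for $0\le j\le n$; $f$ is regarded as the function $\omega\mapsto f(\omega_0,\dots,\omega_n)$ on $A^{\mathbb Z}$. Every such $f$ is bounded. **Theorem.** Let $\mu$ be a shift-invariant probability measure on $A^{\mathbb Z}$ compatible with a kernel $g$ such that $\Gamma(g)>0$. Then for all $f\in\mathcal L$ and $\theta\in\mathbb R$, $$\mathbb E_\mu\Big[e^{\theta(f-\mathbb E_\mu[f])}\Big]\le \exp\Big(\frac{\theta^2\,\Gamma(g)^{-2}}{8}\,\|\delta(f)\|_2^2\Big);$$ in particular (with $\theta=1$) $\mu$ satisfies the Gaussian concentration bound $\mathbb E_\mu[e^{f-\mathbb E_\mu[f]}]\le e^{C\|\delta(f)\|_2^2}$ for all $f\in\mathcal L$, with $C=\Gamma(g)^{-2}/8>0$. Moreover, for all $f\in\mathcal L$ and $u>0$, $$\mu\big(|f-\mathbb E_\mu[f]|>u\big)\le 2\exp\Big(-\frac{2u^2}{\Gamma(g)^{-2}\,\|\delta(f)\|_2^2}\Big),$$ where the right-hand side is read as $0$ if $\|\delta(f)\|_2=0$.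 -/

import Mathlib

open MeasureTheory
open scoped Topology

namespace SCUM

/-- Left-infinite sequences: `x k` is the symbol `k + 1` steps back in time, i.e. the
coordinate with index `-(k + 1)` of a sequence indexed by the integers `≤ -1`. -/
abbrev Past (A : Type*) : Type _ := ℕ → A

/-- A (shift-invariant) probability kernel; `g.prob a x` is `g(a | x)`. -/
structure GKernel (A : Type*) where
  prob : A → Past A → ℝ
  mem_Icc : ∀ a x, prob a x ∈ Set.Icc (0 : ℝ) 1
  hasSum_one : ∀ x, HasSum (fun a => prob a x) 1

/-- Total variation distance `(1/2) ∑ₐ |g(a | z) - g(a | z')|` (the series always converges). -/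
noncomputable def GKernel.tv {A : Type*} (g : GKernel A) (z z' : Past A) : ℝ :=
  (1 / 2) * ∑' a, |g.prob a z - g.prob a z'|

/-- The variation of order `j`: the supremum of the total variation distance over all pairs of
pasts that agree on the `j` most recent coordinates (on all pairs of pasts when `j = 0`). -/
noncomputable def GKernel.variation {A : Type*} (g : GKernel A) (j : ℕ) : ℝ :=
  sSup {r : ℝ | ∃ z z' : Past A, (∀ k, k < j → z k = z' k) ∧ r = g.tv z z'}

/-- `Γ(g) = ∏_{j ≥ 0} (1 - Var_j(g))`. The product always converges, see
`GKernel.multipliable`. -/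
noncomputable def GKernel.Gam {A : Type*} (g : GKernel A) : ℝ :=
  ∏' j : ℕ, (1 - g.variation j)

theorem GKernel.tv_mem_Icc {A : Type*} (g : GKernel A) (z z' : Past A) :
    g.tv z z' ∈ Set.Icc (0 : ℝ) 1 := by
  have hs := (g.hasSum_one z).add (g.hasSum_one z')
  have hle : ∀ a, |g.prob a z - g.prob a z'| ≤ g.prob a z + g.prob a z' := fun a => by
    have h1 := (g.mem_Icc a z).1
    have h2 := (g.mem_Icc a z').1
    rw [abs_le]
    constructor <;> linarith
  have hsum : Summable fun a => |g.prob a z - g.prob a z'| :=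
    Summable.of_nonneg_of_le (fun _ => abs_nonneg _) hle hs.summable
  have h := hsum.tsum_le_tsum hle hs.summable
  rw [hs.tsum_eq] at h
  have h0 : 0 ≤ ∑' a, |g.prob a z - g.prob a z'| := tsum_nonneg fun _ => abs_nonneg _
  unfold GKernel.tv
  constructor <;> linarith

theorem GKernel.variation_mem_Icc {A : Type*} (g : GKernel A) (j : ℕ) :
    g.variation j ∈ Set.Icc (0 : ℝ) 1 := by
  constructor
  · apply Real.sSup_nonneg
    rintro r ⟨z, z', -, rfl⟩
    exact (g.tv_mem_Icc z z').1
  · apply Real.sSup_le _ zero_le_one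
    rintro r ⟨z, z', -, rfl⟩
    exact (g.tv_mem_Icc z z').2

theorem GKernel.multipliable {A : Type*} (g : GKernel A) :
    Multipliable fun j : ℕ => 1 - g.variation j := by
  have hm : ∀ j, 0 ≤ 1 - g.variation j ∧ 1 - g.variation j ≤ 1 := fun j => by
    have h := g.variation_mem_Icc j
    exact ⟨by linarith [h.2], by linarith [h.1]⟩
  have hanti : Antitone fun s : Finset ℕ => ∏ j ∈ s, (1 - g.variation j) := by
    intro s t hst
    show ∏ j ∈ t, (1 - g.variation j) ≤ ∏ j ∈ s, (1 - g.variation j)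
    rw [← Finset.prod_sdiff hst]
    exact mul_le_of_le_one_left (Finset.prod_nonneg fun i _ => (hm i).1)
      (Finset.prod_le_one (fun i _ => (hm i).1) fun i _ => (hm i).2)
  have hb : BddBelow (Set.range fun s : Finset ℕ => ∏ j ∈ s, (1 - g.variation j)) := by
    refine ⟨0, ?_⟩
    rintro _ ⟨s, rfl⟩
    exact Finset.prod_nonneg fun i _ => (hm i).1
  refine ⟨⨅ s : Finset ℕ, ∏ j ∈ s, (1 - g.variation j), ?_⟩
  unfold HasProd
  rw [SummationFilter.unconditional_filter]
  exact tendsto_atTop_ciInf hanti hb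

/-- The shift `(T ω)_i = ω_{i+1}` on bi-infinite sequences. -/
def shift {A : Type*} (ω : ℤ → A) : ℤ → A := fun i => ω (i + 1)

/-- The past `(…, ω_{n-2}, ω_{n-1})` of `ω` before time `n`. -/
def pastAt {A : Type*} (n : ℤ) (ω : ℤ → A) : Past A := fun k => ω (n - 1 - k)

/-- The sigma-algebra generated by the coordinates with index `≤ n - 1`. -/
abbrev pastSigma (A : Type*) [MeasurableSpace A] (n : ℤ) : MeasurableSpace (ℤ → A) :=
  MeasurableSpace.comap (pastAt n) inferInstance

theorem pastSigma_le (A : Type*) [MeasurableSpace A] (n : ℤ) :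
    pastSigma A n ≤ MeasurableSpace.pi := by
  refine Measurable.comap_le ?_
  unfold pastAt
  fun_prop

/-- `μ` is compatible with `g`: for all `n` and `a`, the conditional probability of `ω_n = a`
given the past before time `n` is almost surely `g(a | …, ω_{n-2}, ω_{n-1})`. -/
def Compatible {A : Type*} [MeasurableSpace A] (μ : Measure (ℤ → A)) (g : GKernel A) : Prop :=
  ∀ (n : ℤ) (a : A),
    μ[Set.indicator {ω : ℤ → A | ω n = a} (fun _ => (1 : ℝ)) | pastSigma A n]
      =ᵐ[μ] fun ω => g.prob a (pastAt n ω)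

/-- The set of all `|f(ω with j-th symbol a) - f(ω with j-th symbol b)|`. -/
def oscSet {A : Type*} {n : ℕ} (f : (Fin (n + 1) → A) → ℝ) (j : Fin (n + 1)) : Set ℝ :=
  {r | ∃ (ω : Fin (n + 1) → A) (a b : A),
    r = |f (Function.update ω j a) - f (Function.update ω j b)|}

/-- `δ_j(f)`, for `f` with finite oscillations. -/
noncomputable def osc {A : Type*} {n : ℕ} (f : (Fin (n + 1) → A) → ℝ) (j : Fin (n + 1)) : ℝ :=
  sSup (oscSet f j)

/-- The class of functions of the `n + 1` symbols `ω_0, …, ω_n` with `δ_j(f) < ∞` for all `j`. -/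
def FiniteOsc {A : Type*} {n : ℕ} (f : (Fin (n + 1) → A) → ℝ) : Prop :=
  ∀ j, BddAbove (oscSet f j)

/-- `‖δ(f)‖₂² = ∑_j δ_j(f)²`. -/
noncomputable def oscNormSq {A : Type*} {n : ℕ} (f : (Fin (n + 1) → A) → ℝ) : ℝ :=
  ∑ j, osc f j ^ 2

/-- A function of `n + 1` symbols, seen as the function `ω ↦ f(ω_0, …, ω_n)` of a bi-infinite
sequence. -/
def cyl {A : Type*} {n : ℕ} (f : (Fin (n + 1) → A) → ℝ) (ω : ℤ → A) : ℝ :=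
  f fun i => ω (i : ℕ)

/-- `μ` satisfies the Gaussian concentration bound with constant `C`. -/
def GCBWith {A : Type*} [MeasurableSpace A] (μ : Measure (ℤ → A)) (C : ℝ) : Prop :=
  0 < C ∧ ∀ (n : ℕ) (f : (Fin (n + 1) → A) → ℝ), FiniteOsc f →
    Integrable (cyl f) μ ∧
    Integrable (fun ω => Real.exp (cyl f ω - ∫ η, cyl f η ∂μ)) μ ∧
    ∫ ω, Real.exp (cyl f ω - ∫ η, cyl f η ∂μ) ∂μ ≤ Real.exp (C * oscNormSq f)

end SCUM

/-! ### Visits to zero of the house-of-cards chain. -/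

namespace SCUM

/-! Read `f` as a function `h` of the past and integrate out its symbols one at a time, newest
first. Each step replaces `h` by its image under the transfer operator (`GKernel.integral_transfer`)
and, by Hoeffding's lemma for the law of the newest symbol, costs a factor `exp (θ² c² / 8)`, where
`c` bounds the oscillation in that symbol (`GKernel.transfer_exp_le`).

After `m` steps this oscillation is controlled by coupling. Two pasts agreeing on their last `j`
symbols can be extended by equal symbols with probability at least `1 - Var_j`; otherwise the
agreement length is reset to `0`. Comparison with the house-of-cards chain
(`GKernel.iterate_transfer_sub_le`) gives `c_m = ∑_{i ≤ m} δ_i p_{m-i}`, where `p_l` is its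
probability of return to `0` at time `l`.

The chain never returns with probability at least `Γ`, so `∑ p_l ≤ Γ⁻¹` (`sum_resetProb_le`), and
Young's inequality (`sum_sq_convolution_le`) yields `∑ c_m² ≤ Γ⁻² ∑ δ_i²`. Since `p_l → 0`, the
iterates converge uniformly to the mean of `h`, which closes the estimate in
`GKernel.integral_exp_le`. -/

/-- The probability that the house-of-cards chain started at `j`, which moves from `i` to `0` with
probability `v i` and to `i + 1` otherwise, is at `0` after `l` steps. -/
def resetProb (v : ℕ → ℝ) : ℕ → ℕ → ℝ
  | 0, j => if j = 0 then 1 else 0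
  | l + 1, j => (1 - v j) * resetProb v l (j + 1) + v j * resetProb v l 0

section resetProb

variable {v : ℕ → ℝ}

theorem resetProb_nonneg (hv : ∀ j, v j ∈ Set.Icc (0 : ℝ) 1) (l j : ℕ) :
    0 ≤ resetProb v l j := by
  induction l generalizing j with
  | zero => unfold resetProb; split_ifs <;> norm_num
  | succ l ih =>
    have := (hv j).1
    have := sub_nonneg.2 (hv j).2
    have := ih (j + 1)
    have := ih 0
    unfold resetProb
    positivity

/-- A longer initial agreement makes a disagreement at any later time less likely. This makes the
coupled branch the cheaper one in `GKernel.iterate_transfer_sub_le`. -/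
theorem resetProb_antitone (hv : ∀ j, v j ∈ Set.Icc (0 : ℝ) 1) (hanti : Antitone v) (l : ℕ) :
    Antitone (resetProb v l) := by
  induction l with
  | zero =>
    intro i j hij
    unfold resetProb
    split_ifs <;> first | omega | norm_num
  | succ l ih =>
    refine antitone_nat_of_succ_le fun j => ?_
    have h1 := ih (show j + 1 ≤ j + 1 + 1 by omega)
    have h2 := ih (Nat.zero_le (j + 1))
    have h3 := hanti (show j ≤ j + 1 by omega)
    have h4 := sub_nonneg.2 (hv (j + 1)).2
    have h5 := mul_le_mul_of_nonneg_left h1 h4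
    have h6 := mul_nonneg (sub_nonneg.2 h3) (sub_nonneg.2 h2)
    simp only [resetProb]
    linarith

/-- With `P_j = ∏_{i<j} (1 - v_i)`, the function `G j = γ⁻¹ - P_j⁻¹` solves the first-step equation
`G j = (1 - v_j) G (j+1) + v_j (1 + G 0)` for expected visits to `0` at positive times, because `(1
- v_j) / P_{j+1} = 1 / P_j`. Induction on the time horizon then propagates the bound for all `j` at
once. -/
theorem sum_resetProb_succ_le (hv : ∀ j, v j ∈ Set.Icc (0 : ℝ) 1) {γ : ℝ} (hγ : 0 < γ)
    (hle : ∀ j, γ ≤ ∏ i ∈ Finset.range j, (1 - v i)) (N j : ℕ) :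
    ∑ l ∈ Finset.range N, resetProb v (l + 1) j ≤
      γ⁻¹ - (∏ i ∈ Finset.range j, (1 - v i))⁻¹ := by
  induction N generalizing j with
  | zero =>
    simpa using inv_anti₀ hγ (hle j)
  | succ N ih =>
    have hsum : ∀ i, ∑ l ∈ Finset.range (N + 1), resetProb v l i =
        ∑ l ∈ Finset.range N, resetProb v (l + 1) i + if i = 0 then 1 else 0 := fun i => by
      rw [Finset.sum_range_succ']; rfl
    have h1 := ih (j + 1)
    have h0 := ih 0
    have hpos : ∀ j, 0 < ∏ i ∈ Finset.range j, (1 - v i) := fun j => hγ.trans_le (hle j)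
    have hj : (1 - v j) * (∏ i ∈ Finset.range (j + 1), (1 - v i))⁻¹ =
        (∏ i ∈ Finset.range j, (1 - v i))⁻¹ := by
      have hne := (hpos (j + 1)).ne'
      rw [Finset.prod_range_succ] at hne ⊢
      have := left_ne_zero_of_mul hne
      have := right_ne_zero_of_mul hne
      field_simp
    simp only [resetProb, Finset.sum_add_distrib, ← Finset.mul_sum]
    rw [hsum, hsum, if_neg (by omega), if_pos rfl]
    simp only [Finset.range_zero, Finset.prod_empty, inv_one] at h0
    have h2 := mul_le_mul_of_nonneg_left h1 (sub_nonneg.2 (hv j).2)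
    have h3 := mul_le_mul_of_nonneg_left h0 (hv j).1
    rw [mul_sub, hj] at h2
    linarith

theorem sum_resetProb_le (hv : ∀ j, v j ∈ Set.Icc (0 : ℝ) 1) {γ : ℝ} (hγ : 0 < γ)
    (hle : ∀ j, γ ≤ ∏ i ∈ Finset.range j, (1 - v i)) (N : ℕ) :
    ∑ l ∈ Finset.range N, resetProb v l 0 ≤ γ⁻¹ := by
  refine (Finset.sum_le_sum_of_subset_of_nonneg (Finset.range_mono N.le_succ)
    fun l _ _ => resetProb_nonneg hv l 0).trans ?_
  have h := sum_resetProb_succ_le hv hγ hle N 0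
  rw [Finset.sum_range_succ']
  simp only [Finset.range_zero, Finset.prod_empty, inv_one] at h
  simp only [resetProb, if_true] at h ⊢
  linarith

end resetProb

/-- Young's inequality for the convolution of sequences. -/
theorem sum_sq_convolution_le {u δ : ℕ → ℝ} (hu : ∀ l, 0 ≤ u l)
    {U : ℝ} (hU : ∀ N, ∑ l ∈ Finset.range N, u l ≤ U) (m : ℕ) :
    ∑ i ∈ Finset.range m, (∑ l ∈ Finset.range (i + 1), δ l * u (i - l)) ^ 2 ≤
      U ^ 2 * ∑ l ∈ Finset.range m, δ l ^ 2 := by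
  have hU0 : 0 ≤ U := by simpa using hU 0
  -- Cauchy–Schwarz with weights `u (i - l)`, whose total mass is at most `U`.
  have hrow : ∀ i, (∑ l ∈ Finset.range (i + 1), δ l * u (i - l)) ^ 2 ≤
      U * ∑ l ∈ Finset.range (i + 1), δ l ^ 2 * u (i - l) := fun i => by
    refine (Finset.sum_sq_le_sum_mul_sum_of_sq_le_mul (Finset.range (i + 1))
      (f := fun l => u (i - l)) (g := fun l => δ l ^ 2 * u (i - l)) (fun l _ => hu _)
      (fun l _ => mul_nonneg (sq_nonneg _) (hu _)) fun l _ => le_of_eq (by ring)).trans ?_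
    refine mul_le_mul_of_nonneg_right ?_
      (Finset.sum_nonneg fun l _ => mul_nonneg (sq_nonneg _) (hu _))
    have := Finset.sum_range_reflect u (i + 1)
    simp only [Nat.add_sub_cancel] at this
    exact this.le.trans (hU _)
  refine (Finset.sum_le_sum fun i _ => hrow i).trans ?_
  rw [← Finset.mul_sum, sq, mul_assoc]
  refine mul_le_mul_of_nonneg_left ?_ hU0
  rw [Finset.sum_range_diag_flip m fun l k => δ l ^ 2 * u k, Finset.mul_sum]
  refine Finset.sum_le_sum fun l _ => ?_
  rw [← Finset.mul_sum, mul_comm U]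
  exact mul_le_mul_of_nonneg_left (hU _) (sq_nonneg _)

end SCUM

/-! ### Transfer operator and coupling of pasts. -/

namespace SCUM

variable {A : Type*}

/-- The past `x` extended by the most recent symbol `a`. -/
def Past.cons (a : A) (x : Past A) : Past A
  | 0 => a
  | k + 1 => x k

theorem pastAt_add_one (n : ℤ) (ω : ℤ → A) :
    pastAt (n + 1) ω = Past.cons (ω n) (pastAt n ω) := by
  funext k
  cases k with
  | zero => simp [pastAt, Past.cons]
  | succ k =>
    simp only [pastAt, Past.cons]
    congr 1
    push_cast
    ring

open Classical in
theorem Past.sum_cons_ne_le {δ : ℕ → ℝ} (hδ : ∀ k, 0 ≤ δ k) (n m : ℕ) (a b : A)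
    (x x' : Past A) :
    (∑ k ∈ Finset.range n, if Past.cons a x k = Past.cons b x' k then 0 else δ (k + m)) ≤
      (∑ k ∈ Finset.range n, if x k = x' k then 0 else δ (k + (m + 1))) +
        if a = b then 0 else δ m := by
  -- The extra term `k = n` lets the new symbol be split off while keeping all `n` old coordinates.
  calc _ ≤ ∑ k ∈ Finset.range (n + 1),
        (if Past.cons a x k = Past.cons b x' k then 0 else δ (k + m)) := by
        refine Finset.sum_le_sum_of_subset_of_nonneg (Finset.range_mono n.le_succ) ?_
        intro k _ _
        split_ifs
        exacts [le_rfl, hδ _]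
    _ = _ := by
        rw [Finset.sum_range_succ']
        simp only [Past.cons, zero_add]
        congr 1
        refine Finset.sum_congr rfl fun k _ => ?_
        rw [show k + 1 + m = k + (m + 1) by ring]
        split_ifs <;> simp [*]

namespace GKernel

variable (g : GKernel A)

theorem prob_nonneg (a : A) (x : Past A) : 0 ≤ g.prob a x := (g.mem_Icc a x).1

theorem summable_prob_mul (x : Past A) {F : A → ℝ} {K : ℝ} (hF : ∀ a, |F a| ≤ K) :
    Summable fun a => g.prob a x * F a := by
  refine Summable.of_norm_bounded ((g.hasSum_one x).summable.mul_right K) fun a => ?_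
  rw [norm_mul, Real.norm_of_nonneg (g.prob_nonneg a x)]
  exact mul_le_mul_of_nonneg_left (hF a) (g.prob_nonneg a x)

theorem tv_le_variation {j : ℕ} {z z' : Past A} (h : ∀ k, k < j → z k = z' k) :
    g.tv z z' ≤ g.variation j := by
  refine le_csSup ⟨1, ?_⟩ ⟨z, z', h, rfl⟩
  rintro r ⟨z, z', -, rfl⟩
  exact (g.tv_mem_Icc z z').2

theorem variation_antitone [Nonempty A] : Antitone g.variation := by
  intro i j hij
  refine csSup_le ?_ ?_
  · let z : Past A := fun _ => Classical.arbitrary A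
    exact ⟨_, z, z, fun _ _ => rfl, rfl⟩
  · rintro r ⟨z, z', h, rfl⟩
    exact g.tv_le_variation fun k hk => h k (hk.trans_le hij)

theorem Gam_le_prod (j : ℕ) : g.Gam ≤ ∏ i ∈ Finset.range j, (1 - g.variation i) := by
  have hanti : Antitone fun j => ∏ i ∈ Finset.range j, (1 - g.variation i) := by
    refine antitone_nat_of_succ_le fun j => ?_
    rw [Finset.prod_range_succ]
    refine mul_le_of_le_one_right (Finset.prod_nonneg fun i _ => ?_) ?_
    · exact sub_nonneg.2 (g.variation_mem_Icc i).2
    · linarith [(g.variation_mem_Icc j).1]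
  exact hanti.le_of_tendsto g.multipliable.hasProd.tendsto_prod_nat j

/-- `1 - Var_j` is the ratio of consecutive partial products, which share the nonzero limit `Γ`. -/
theorem tendsto_variation (hg : 0 < g.Gam) :
    Filter.Tendsto g.variation Filter.atTop (𝓝 0) := by
  have h := g.multipliable.hasProd.tendsto_prod_nat
  have h1 := (h.comp (Filter.tendsto_add_atTop_nat 1)).div h hg.ne'
  rw [show (∏' j : ℕ, (1 - g.variation j)) = g.Gam from rfl, div_self hg.ne'] at h1
  have h2 := h1.const_sub 1
  rw [sub_self] at h2
  refine h2.congr fun j => ?_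
  have hne := (hg.trans_le (g.Gam_le_prod j)).ne'
  simp only [Function.comp, Pi.div_apply, Finset.prod_range_succ]
  field_simp
  ring

theorem abs_prob_sub_le (a : A) (z z' : Past A) :
    |g.prob a z - g.prob a z'| ≤ 2 * g.tv z z' := by
  have hsum : Summable fun a => |g.prob a z - g.prob a z'| :=
    ((g.hasSum_one z).sub (g.hasSum_one z')).summable.abs
  have := hsum.le_tsum a fun _ _ => abs_nonneg _
  unfold tv
  linarith

/-- The transfer operator of the kernel, acting on functions of the past. -/
noncomputable def transfer (h : Past A → ℝ) (x : Past A) : ℝ :=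
  ∑' a, g.prob a x * h (Past.cons a x)

theorem abs_transfer_le {h : Past A → ℝ} {K : ℝ} (hK : ∀ x, |h x| ≤ K) (x : Past A) :
    |g.transfer h x| ≤ K := by
  have := tsum_of_norm_bounded (f := fun a => g.prob a x * h (Past.cons a x))
    ((g.hasSum_one x).mul_right K) fun a => by
      rw [norm_mul, Real.norm_of_nonneg (g.prob_nonneg a x)]
      exact mul_le_mul_of_nonneg_left (hK _) (g.prob_nonneg a x)
  simpa [transfer] using this

theorem abs_iterate_transfer_le {h : Past A → ℝ} {K : ℝ} (hK : ∀ x, |h x| ≤ K) (m : ℕ)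
    (x : Past A) : |g.transfer^[m] h x| ≤ K := by
  induction m generalizing x with
  | zero => exact hK x
  | succ m ih =>
    rw [Function.iterate_succ_apply']
    exact g.abs_transfer_le ih x

/-- The means of two functions under `g(· | x)` and `g(· | x')` differ by at most the cost of a
coupling of the two laws that agrees with probability `1 - v`, if the functions differ by at most
`α` when the symbols agree and by at most `β` in general. -/
theorem tsum_prob_mul_sub_le [Nonempty A] {x x' : Past A} {v α β K : ℝ} (hv : g.tv x x' ≤ v)
    {F F' : A → ℝ} (hF : ∀ a, |F a| ≤ K) (hF' : ∀ a, |F' a| ≤ K) (hα : ∀ a, F a - F' a ≤ α)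
    (hβ : ∀ a b, F a - F' b ≤ β) (hαβ : α ≤ β) :
    ∑' a, g.prob a x * F a - ∑' a, g.prob a x' * F' a ≤ (1 - v) * α + v * β := by
  -- On the mass left after removing the common part, `F ≤ M` and `F' ≥ M - β`. This replaces an
  -- explicit coupling of the residual laws.
  set M := ⨆ a, F a
  have hbdd : BddAbove (Set.range F) := ⟨K, by rintro _ ⟨a, rfl⟩; exact (abs_le.1 (hF a)).2⟩
  have hM : ∀ a, F a ≤ M := fun a => le_ciSup hbdd a
  have hM' : ∀ b, M ≤ F' b + β := fun b => ciSup_le fun a => by linarith [hβ a b]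
  have hs := g.summable_prob_mul x hF
  have hs' := g.summable_prob_mul x' hF'
  have hd : Summable fun a => |g.prob a x - g.prob a x'| :=
    ((g.hasSum_one x).sub (g.hasSum_one x')).summable.abs
  have htv : HasSum (fun a => |g.prob a x - g.prob a x'|) (2 * g.tv x x') := by
    convert hd.hasSum using 1
    unfold tv
    ring
  have hx := g.hasSum_one x
  have hx' := g.hasSum_one x'
  -- the common mass pays `α`, the rest pays `β`
  have hbound : HasSum (fun a =>
      (g.prob a x + g.prob a x' - |g.prob a x - g.prob a x'|) / 2 * α
        + (g.prob a x - (g.prob a x + g.prob a x' - |g.prob a x - g.prob a x'|) / 2) * M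
        - (g.prob a x' - (g.prob a x + g.prob a x' - |g.prob a x - g.prob a x'|) / 2) * (M - β))
      ((1 + 1 - 2 * g.tv x x') / 2 * α + (1 - (1 + 1 - 2 * g.tv x x') / 2) * M
        - (1 - (1 + 1 - 2 * g.tv x x') / 2) * (M - β)) := by
    have hc := ((hx.add hx').sub htv).div_const 2
    exact ((hc.mul_right α).add ((hx.sub hc).mul_right M)).sub ((hx'.sub hc).mul_right (M - β))
  refine (hasSum_le ?_ (hs.hasSum.sub hs'.hasSum) hbound).trans ?_
  · intro a
    have hp := g.prob_nonneg a x
    have hq := g.prob_nonneg a x'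
    set c := (g.prob a x + g.prob a x' - |g.prob a x - g.prob a x'|) / 2 with hc
    have habs := abs_le.1 (le_refl |g.prob a x - g.prob a x'|)
    have h0 : 0 ≤ c := by
      rcases abs_cases (g.prob a x - g.prob a x') with h | h <;> rw [hc, h.1] <;> linarith
    have h1 : c ≤ g.prob a x := by rw [hc]; linarith
    have h2 : c ≤ g.prob a x' := by rw [hc]; linarith
    have e1 := mul_le_mul_of_nonneg_left (hα a) h0
    have e2 := mul_le_mul_of_nonneg_left (hM a) (sub_nonneg.2 h1)
    have e3 := mul_le_mul_of_nonneg_left (show M - β ≤ F' a by linarith [hM' a])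
      (sub_nonneg.2 h2)
    linarith
  · have := mul_nonneg (sub_nonneg.2 hv) (sub_nonneg.2 hαβ)
    linarith

open Classical in
/-- The effect of the past on iterates of the transfer operator: `x` and `x'` agree on the last
`j` symbols and `h` has oscillation at most `δ k` in the coordinate `k`. -/
theorem iterate_transfer_sub_le [Nonempty A] {h : Past A → ℝ} {K : ℝ} (hK : ∀ x, |h x| ≤ K)
    {δ : ℕ → ℝ} (hδ : ∀ k, 0 ≤ δ k) {n : ℕ}
    (hh : ∀ x x', h x - h x' ≤ ∑ k ∈ Finset.range n, if x k = x' k then 0 else δ k)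
    (m j : ℕ) {x x' : Past A} (hx : ∀ k, k < j → x k = x' k) :
    g.transfer^[m] h x - g.transfer^[m] h x' ≤
      ∑ i ∈ Finset.range m, δ i * resetProb g.variation (m - i) j
        + ∑ k ∈ Finset.range n, if x k = x' k then 0 else δ (k + m) := by
  induction m generalizing j x x' with
  | zero => simpa using hh x x'
  | succ m ih =>
    set R : ℝ := ∑ k ∈ Finset.range n, if x k = x' k then 0 else δ (k + (m + 1)) with hR
    have hvar := g.variation_mem_Icc
    set S : ℕ → ℝ := fun i => ∑ l ∈ Finset.range m, δ l * resetProb g.variation (m - l) i with hS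
    have hmono : S (j + 1) ≤ S 0 := Finset.sum_le_sum fun l _ =>
      mul_le_mul_of_nonneg_left (resetProb_antitone hvar g.variation_antitone _ (Nat.zero_le _))
        (hδ l)
    rw [Function.iterate_succ_apply']
    -- Equal new symbols lengthen the agreement to `j + 1`; distinct ones reset it to `0` and add `δ
    -- m`, since a symbol drawn now sits at coordinate `m` after the remaining `m` steps.
    have key := g.tsum_prob_mul_sub_le (x := x) (x' := x') (g.tv_le_variation hx)
      (F := fun a => g.transfer^[m] h (Past.cons a x))
      (F' := fun a => g.transfer^[m] h (Past.cons a x'))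
      (α := S (j + 1) + R) (β := S 0 + δ m + R)
      (fun a => g.abs_iterate_transfer_le hK m _) (fun a => g.abs_iterate_transfer_le hK m _)
      (fun a => ?_) (fun a b => ?_) (by linarith [hδ m])
    · refine key.trans (le_of_eq ?_)
      have hsum : ∀ i, ∑ l ∈ Finset.range (m + 1), δ l * resetProb g.variation (m - l) i =
          S i + if i = 0 then δ m else 0 := fun i => by
        rw [Finset.sum_range_succ, Nat.sub_self]
        simp [resetProb, hS]
      have : ∑ l ∈ Finset.range (m + 1), δ l * resetProb g.variation (m + 1 - l) j =
          (1 - g.variation j) * ∑ l ∈ Finset.range (m + 1), δ l * resetProb g.variation (m - l) (j + 1)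
          + g.variation j * ∑ l ∈ Finset.range (m + 1), δ l * resetProb g.variation (m - l) 0 := by
        rw [Finset.mul_sum, Finset.mul_sum, ← Finset.sum_add_distrib]
        refine Finset.sum_congr rfl fun l hl => ?_
        rw [Nat.succ_sub (Nat.lt_succ_iff.1 (Finset.mem_range.1 hl))]
        simp only [resetProb]
        ring
      rw [this, hsum, hsum, if_neg (by omega), if_pos rfl]
      ring
    · refine (ih (j + 1) (x := Past.cons a x) (x' := Past.cons a x') ?_).trans ?_
      · rintro (_ | k) hk
        · rfl
        · exact hx k (by omega)
      · have := Past.sum_cons_ne_le hδ n m a a x x'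
        rw [if_pos rfl] at this
        simp only [hS]
        linarith
    · refine (ih 0 (x := Past.cons a x) (x' := Past.cons b x') (by simp)).trans ?_
      have := Past.sum_cons_ne_le hδ n m a b x x'
      have h2 : (if a = b then 0 else δ m) ≤ δ m := by split_ifs; exacts [hδ m, le_rfl]
      simp only [hS]
      linarith

end GKernel

/-! ### Measurability, Hoeffding's lemma and the Markov property. -/

theorem measurable_pastAt [MeasurableSpace A] (n : ℤ) : Measurable (pastAt (A := A) n) := by
  unfold pastAt
  fun_prop

theorem Past.measurable_cons [MeasurableSpace A] (a : A) : Measurable (Past.cons a) := by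
  refine measurable_pi_lambda _ fun k => ?_
  cases k with
  | zero => exact measurable_const
  | succ k => exact measurable_pi_apply k

namespace GKernel

variable (g : GKernel A)

/-- Measurability is not part of a kernel; it follows from `Var_j → 0`, which makes `g(a | ·)` a
uniform limit of functions of finitely many symbols. -/
theorem measurable_prob [Nonempty A] [Countable A] [MeasurableSpace A] [DiscreteMeasurableSpace A]
    (hg : 0 < g.Gam) (a : A) : Measurable (g.prob a) := by
  let r : ℕ → Past A → Past A := fun j x k => if k < j then x k else Classical.arbitrary A
  refine measurable_of_tendsto_metrizable (f := fun j x => g.prob a (r j x)) (fun j => ?_) ?_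
  · let e : (Fin j → A) → Past A := fun y k => if h : k < j then y ⟨k, h⟩ else Classical.arbitrary A
    have he : (fun x => g.prob a (r j x)) =
        (fun y => g.prob a (e y)) ∘ fun (x : Past A) (i : Fin j) => x i := by
      funext x
      simp only [Function.comp, r, e]
      congr 1
    rw [he]
    exact (measurable_of_countable _).comp (by fun_prop)
  · rw [tendsto_pi_nhds]
    intro x
    rw [tendsto_iff_norm_sub_tendsto_zero]
    refine squeeze_zero (fun _ => norm_nonneg _) (fun j => (g.abs_prob_sub_le a _ _).trans
      (mul_le_mul_of_nonneg_left (g.tv_le_variation (j := j) fun k hk => ?_) zero_le_two)) ?_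
    · simp [r, hk]
    · simpa using (g.tendsto_variation hg).const_mul 2

theorem measurable_transfer [Nonempty A] [Countable A] [MeasurableSpace A]
    [DiscreteMeasurableSpace A] (hg : 0 < g.Gam) {h : Past A → ℝ} (hh : Measurable h) :
    Measurable (g.transfer h) := by
  unfold transfer
  exact Measurable.tsum fun a => (g.measurable_prob hg a).mul (hh.comp (Past.measurable_cons a))

theorem measurable_iterate_transfer [Nonempty A] [Countable A] [MeasurableSpace A]
    [DiscreteMeasurableSpace A] (hg : 0 < g.Gam) {h : Past A → ℝ} (hh : Measurable h) (m : ℕ) :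
    Measurable (g.transfer^[m] h) := by
  induction m with
  | zero => exact hh
  | succ m ih =>
    rw [Function.iterate_succ_apply']
    exact g.measurable_transfer hg ih

/-- The law `g(· | x)` of the next symbol. -/
noncomputable def toPMF (x : Past A) : PMF A :=
  ⟨fun a => ENNReal.ofReal (g.prob a x), by
    have h := g.hasSum_one x
    rw [← ENNReal.ofReal_one, ← h.tsum_eq, ENNReal.ofReal_tsum_of_nonneg
      (fun a => g.prob_nonneg a x) h.summable]
    exact ENNReal.summable.hasSum⟩

theorem integral_toPMF [MeasurableSpace A] [DiscreteMeasurableSpace A] (x : Past A) {F : A → ℝ}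
    {K : ℝ} (hF : ∀ a, |F a| ≤ K) :
    ∫ a, F a ∂(g.toPMF x).toMeasure = ∑' a, g.prob a x * F a := by
  rw [PMF.integral_eq_tsum]
  · refine tsum_congr fun a => ?_
    rw [smul_eq_mul, show g.toPMF x a = ENNReal.ofReal (g.prob a x) from rfl,
      ENNReal.toReal_ofReal (g.prob_nonneg a x)]
  · exact Integrable.of_bound Measurable.of_discrete.aestronglyMeasurable K
      (Filter.Eventually.of_forall hF)

/-- Hoeffding's lemma for the law `g(· | x)`: under it, `h (Past.cons a x)` takes values in an
interval of length `c` and has mean `g.transfer h x`. -/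
theorem transfer_exp_le [MeasurableSpace A] [DiscreteMeasurableSpace A] {h : Past A → ℝ} {K : ℝ}
    (hK : ∀ x, |h x| ≤ K) (x : Past A) {c : ℝ}
    (hc : ∀ a b, h (Past.cons a x) - h (Past.cons b x) ≤ c) (θ : ℝ) :
    g.transfer (fun y => Real.exp (θ * h y)) x ≤
      Real.exp (θ ^ 2 / 8 * c ^ 2) * Real.exp (θ * g.transfer h x) := by
  have hne : Nonempty A := (g.toPMF x).support_nonempty.to_type
  set F : A → ℝ := fun a => h (Past.cons a x)
  have hF : ∀ a, |F a| ≤ K := fun a => hK _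
  have hbdd : BddBelow (Set.range F) := ⟨-K, by rintro _ ⟨a, rfl⟩; exact (abs_le.1 (hF a)).1⟩
  have hI : ∀ a, F a ∈ Set.Icc (⨅ b, F b) ((⨅ b, F b) + c) := fun a =>
    ⟨ciInf_le hbdd a, by
      have : F a - c ≤ ⨅ b, F b := le_ciInf fun b => by linarith [hc a b]
      linarith⟩
  have hsub := (ProbabilityTheory.hasSubgaussianMGF_of_mem_Icc (μ := (g.toPMF x).toMeasure)
    (X := F) Measurable.of_discrete.aemeasurable (Filter.Eventually.of_forall hI)).mgf_le θ
  have hmean : ∫ a, F a ∂(g.toPMF x).toMeasure = g.transfer h x := g.integral_toPMF x hF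
  have hexp : ∫ a, Real.exp (θ * F a) ∂(g.toPMF x).toMeasure =
      g.transfer (fun y => Real.exp (θ * h y)) x :=
    g.integral_toPMF x (F := fun a => Real.exp (θ * F a)) (K := Real.exp (|θ| * K)) fun a => by
      rw [Real.abs_exp, Real.exp_le_exp]
      refine (le_abs_self _).trans ?_
      rw [abs_mul]
      exact mul_le_mul_of_nonneg_left (hF a) (abs_nonneg _)
  rw [← hexp, ← hmean]
  unfold ProbabilityTheory.mgf at hsub
  have hsplit : ∀ a, Real.exp (θ * F a) = Real.exp (θ * (F a - ∫ a, F a ∂(g.toPMF x).toMeasure)) *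
      Real.exp (θ * ∫ a, F a ∂(g.toPMF x).toMeasure) := fun a => by
    rw [← Real.exp_add]; congr 1; ring
  simp_rw [hsplit, integral_mul_const]
  refine mul_le_mul_of_nonneg_right (hsub.trans (le_of_eq ?_)) (Real.exp_pos _).le
  congr 1
  simp only [add_sub_cancel_left, NNReal.coe_pow, NNReal.coe_div, coe_nnnorm, NNReal.coe_ofNat,
    div_pow, Real.norm_eq_abs, sq_abs]
  ring

/-- The one-step Markov property of a compatible measure. -/
theorem integral_transfer [Nonempty A] [Countable A] [MeasurableSpace A] [DiscreteMeasurableSpace A]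
    (hg : 0 < g.Gam) {μ : Measure (ℤ → A)} [IsProbabilityMeasure μ] (hcomp : Compatible μ g)
    {h : Past A → ℝ} (hh : Measurable h) {K : ℝ} (hK : ∀ x, |h x| ≤ K) (n : ℤ) :
    ∫ ω, g.transfer h (pastAt n ω) ∂μ = ∫ ω, h (pastAt (n + 1) ω) ∂μ := by
  have hK0 : 0 ≤ K := (abs_nonneg _).trans (hK fun _ => Classical.arbitrary A)
  have hset : ∀ a : A, MeasurableSet {ω : ℤ → A | ω n = a} := fun a =>
    measurableSet_eq_fun (measurable_pi_apply n) measurable_const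
  set I : A → (ℤ → A) → ℝ := fun a => Set.indicator {ω : ℤ → A | ω n = a} (fun _ => (1 : ℝ))
    with hI
  have hIint : ∀ a, Integrable (I a) μ := fun a => (integrable_const _).indicator (hset a)
  set H : A → (ℤ → A) → ℝ := fun a ω => h (Past.cons a (pastAt n ω)) with hH
  have hHm : ∀ a, Measurable[pastSigma A n] (H a) := fun a =>
    (hh.comp (Past.measurable_cons a)).comp (comap_measurable _)
  have hHK : ∀ a ω, ‖H a ω‖ ≤ K := fun a ω => hK _
  have hHI : ∀ a, Integrable (I a * H a) μ := fun a =>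
    (hIint a).mul_bdd (((hHm a).mono (pastSigma_le A n) le_rfl).aestronglyMeasurable)
      (Filter.Eventually.of_forall (hHK a))
  have hgm : ∀ a, Measurable fun ω : ℤ → A => g.prob a (pastAt n ω) := fun a =>
    (g.measurable_prob hg a).comp (measurable_pastAt n)
  have hgint : ∀ a, Integrable (fun ω : ℤ → A => g.prob a (pastAt n ω)) μ := fun a =>
    Integrable.of_bound (hgm a).aestronglyMeasurable 1 (Filter.Eventually.of_forall fun ω => by
      rw [Real.norm_of_nonneg (g.prob_nonneg _ _)]; exact (g.mem_Icc _ _).2)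
  have hgH : ∀ a, Integrable (fun ω => g.prob a (pastAt n ω) * H a ω) μ := fun a =>
    (hgint a).mul_bdd (((hHm a).mono (pastSigma_le A n) le_rfl).aestronglyMeasurable)
      (Filter.Eventually.of_forall (hHK a))
  have hone : ∀ a, ∫ ω, g.prob a (pastAt n ω) ∂μ = μ.real {ω | ω n = a} := fun a => by
    rw [← integral_congr_ae (hcomp n a), integral_condExp (pastSigma_le A n),
      integral_indicator_const _ (hset a)]
    simp
  -- `H a` depends only on the past before `n`, so it can be pulled out of the conditional
  -- expectation of the indicator.
  have hterm : ∀ a, ∫ ω, g.prob a (pastAt n ω) * H a ω ∂μ = ∫ ω, I a ω * H a ω ∂μ := fun a => by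
    have h1 := condExp_mul_of_stronglyMeasurable_right (m := pastSigma A n) (μ := μ)
      (hHm a).stronglyMeasurable (hHI a) (hIint a)
    have h2 := integral_condExp (μ := μ) (f := I a * H a) (pastSigma_le A n)
    rw [integral_congr_ae h1] at h2
    refine Eq.trans (integral_congr_ae ?_) h2
    filter_upwards [hcomp n a] with ω hω
    rw [Pi.mul_apply, hω]
  have hsum : Summable fun a => μ.real {ω : ℤ → A | ω n = a} := by
    refine ENNReal.summable_toReal ?_
    rw [← measure_iUnion (fun a b hab => ?_) hset]
    · exact measure_ne_top _ _
    · exact Set.disjoint_left.2 fun ω h1 h2 => hab (h1.symm.trans h2)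
  have hL : ∑' a, ∫ ω, g.prob a (pastAt n ω) * H a ω ∂μ =
      ∫ ω, ∑' a, g.prob a (pastAt n ω) * H a ω ∂μ := by
    refine integral_tsum_of_summable_integral_norm hgH ?_
    refine Summable.of_nonneg_of_le (fun a => integral_nonneg fun _ => norm_nonneg _)
      (fun a => ?_) (hsum.mul_right K)
    rw [← hone, ← integral_mul_const]
    refine integral_mono (hgH a).norm ((hgint a).mul_const K) fun ω => ?_
    simp only [norm_mul, Real.norm_of_nonneg (g.prob_nonneg _ _)]
    exact mul_le_mul_of_nonneg_left (hHK a ω) (g.prob_nonneg _ _)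
  have hR : ∑' a, ∫ ω, I a ω * H a ω ∂μ = ∫ ω, ∑' a, I a ω * H a ω ∂μ := by
    refine integral_tsum_of_summable_integral_norm hHI ?_
    refine Summable.of_nonneg_of_le (fun a => integral_nonneg fun _ => norm_nonneg _)
      (fun a => ?_) (hsum.mul_right K)
    have : ∫ ω, I a ω ∂μ = μ.real {ω | ω n = a} := by
      rw [hI, integral_indicator_const _ (hset a)]; simp
    rw [← this, ← integral_mul_const]
    refine integral_mono (hHI a).norm ((hIint a).mul_const K) fun ω => ?_
    have h0 : 0 ≤ I a ω := Set.indicator_nonneg (fun _ _ => zero_le_one) _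
    simp only [norm_mul, Real.norm_of_nonneg h0]
    exact mul_le_mul_of_nonneg_left (hHK a ω) h0
  unfold transfer
  rw [← hL, tsum_congr hterm, hR]
  refine integral_congr_ae (Filter.Eventually.of_forall fun ω => ?_)
  simp only
  rw [tsum_eq_single (ω n), pastAt_add_one]
  · simp [hI, hH]
  · intro a ha
    have : I a ω = 0 := Set.indicator_of_notMem (fun h => ha h.symm) _
    rw [this, zero_mul]

/-! ### Iteration of the one-step bound. -/

theorem tendsto_resetProb (hg : 0 < g.Gam) :
    Filter.Tendsto (fun l => resetProb g.variation l 0) Filter.atTop (𝓝 0) :=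
  (summable_of_sum_range_le (fun l => resetProb_nonneg g.variation_mem_Icc l 0)
    (sum_resetProb_le g.variation_mem_Icc hg g.Gam_le_prod)).tendsto_atTop_zero

open Classical in
/-- Gaussian bound on the moment generating function of a function of finitely many symbols of
the past, with oscillation at most `δ k` in the coordinate `k`. -/
theorem integral_exp_le [Nonempty A] [Countable A] [MeasurableSpace A] [DiscreteMeasurableSpace A]
    (hg : 0 < g.Gam) {μ : Measure (ℤ → A)} [IsProbabilityMeasure μ] (hcomp : Compatible μ g)
    {h : Past A → ℝ} (hm : Measurable h) {K : ℝ} (hK : ∀ x, |h x| ≤ K)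
    {δ : ℕ → ℝ} (hδ : ∀ k, 0 ≤ δ k) {n : ℕ} (hδn : ∀ k, n ≤ k → δ k = 0)
    (hh : ∀ x x', h x - h x' ≤ ∑ k ∈ Finset.range n, if x k = x' k then 0 else δ k)
    (θ : ℝ) (t : ℤ) :
    ∫ ω, Real.exp (θ * h (pastAt t ω)) ∂μ ≤
      Real.exp (θ ^ 2 / 8 * (g.Gam⁻¹ ^ 2 * ∑ k ∈ Finset.range n, δ k ^ 2)) *
        Real.exp (θ * ∫ ω, h (pastAt t ω) ∂μ) := by
  set ψ : ℕ → Past A → ℝ := fun m => g.transfer^[m] h with hψ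
  have hψK : ∀ m x, |ψ m x| ≤ K := fun m => g.abs_iterate_transfer_le hK m
  have hψm : ∀ m, Measurable (ψ m) := fun m => g.measurable_iterate_transfer hg hm m
  have hψs : ∀ m, ψ (m + 1) = g.transfer (ψ m) := fun m => Function.iterate_succ_apply' _ _ _
  have hexpK : ∀ m x, |Real.exp (θ * ψ m x)| ≤ Real.exp (|θ| * K) := fun m x => by
    rw [Real.abs_exp, Real.exp_le_exp]
    refine (le_abs_self _).trans ?_
    rw [abs_mul]
    exact mul_le_mul_of_nonneg_left (hψK m x) (abs_nonneg _)
  have hexpm : ∀ m, Measurable fun x => Real.exp (θ * ψ m x) := fun m =>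
    ((hψm m).const_mul θ).exp
  have hint : ∀ m s, Integrable (fun ω => Real.exp (θ * ψ m (pastAt s ω))) μ := fun m s =>
    Integrable.of_bound ((hexpm m).comp (measurable_pastAt s)).aestronglyMeasurable _
      (Filter.Eventually.of_forall fun ω => hexpK m _)
  have hψint : ∀ m s, Integrable (fun ω => ψ m (pastAt s ω)) μ := fun m s =>
    Integrable.of_bound ((hψm m).comp (measurable_pastAt s)).aestronglyMeasurable K
      (Filter.Eventually.of_forall fun ω => hψK m _)
  set p : ℕ → ℝ := fun l => resetProb g.variation l 0 with hp
  set S : ℕ → ℝ := fun m => ∑ i ∈ Finset.range m, δ i * p (m - i) with hS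
  -- The term `i = m`, with `p 0 = 1`, is the direct effect of the newest symbol; the others,
  -- collected in `S m`, come from the `m` symbols drawn after it.
  set c : ℕ → ℝ := fun m => ∑ i ∈ Finset.range (m + 1), δ i * p (m - i) with hc
  have hcS : ∀ m, c m = S m + δ m := fun m => by
    simp [hc, hS, hp, Finset.sum_range_succ, resetProb]
  have hosc : ∀ m x x', ψ m x - ψ m x' ≤
      S m + ∑ k ∈ Finset.range n, if x k = x' k then 0 else δ (k + m) := fun m x x' =>
    g.iterate_transfer_sub_le hK hδ hh m 0 (by simp)
  have hstep : ∀ m a b x, ψ m (Past.cons a x) - ψ m (Past.cons b x) ≤ c m := fun m a b x => by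
    refine (hosc m _ _).trans ?_
    have h1 := Past.sum_cons_ne_le hδ n m a b x x
    have h2 : (if a = b then 0 else δ m) ≤ δ m := by split_ifs; exacts [hδ m, le_rfl]
    simp only [if_true, Finset.sum_const_zero, zero_add] at h1
    rw [hcS]
    linarith
  have hmean : ∀ m : ℕ, ∫ ω, ψ m (pastAt (t - m) ω) ∂μ = ∫ ω, h (pastAt t ω) ∂μ := fun m => by
    induction m with
    | zero => simp [hψ]
    | succ m ih =>
      rw [← ih, hψs, g.integral_transfer hg hcomp (hψm m) (hψK m)]
      push_cast
      simp only [sub_add_eq_sub_sub, sub_add_cancel]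
  have hiter : ∀ m : ℕ, ∫ ω, Real.exp (θ * h (pastAt t ω)) ∂μ ≤
      Real.exp (θ ^ 2 / 8 * ∑ i ∈ Finset.range m, c i ^ 2) *
        ∫ ω, Real.exp (θ * ψ m (pastAt (t - m) ω)) ∂μ := fun m => by
    induction m with
    | zero => simp [hψ]
    | succ m ih =>
      refine ih.trans ?_
      rw [Finset.sum_range_succ, mul_add, Real.exp_add, mul_assoc]
      refine mul_le_mul_of_nonneg_left ?_ (Real.exp_pos _).le
      have h1 := g.integral_transfer hg hcomp (hexpm m) (hexpK m) (t - (m + 1 : ℕ))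
      have h2 : t - ((m + 1 : ℕ) : ℤ) + 1 = t - m := by push_cast; ring
      rw [h2] at h1
      rw [← h1, ← integral_const_mul]
      refine integral_mono_of_nonneg (Filter.Eventually.of_forall fun ω => tsum_nonneg fun a =>
        mul_nonneg (g.prob_nonneg _ _) (Real.exp_pos _).le) ((hint _ _).const_mul _)
        (Filter.Eventually.of_forall fun ω => ?_)
      simp only [hψs]
      exact g.transfer_exp_le (hψK m) _ (fun a b => hstep m a b _) θ
  -- For `m ≥ n` the original past has left the window on which `h` depends, so `ψ m` varies by at
  -- most `S m` and is that close to its own mean, which is the mean of `h`.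
  have hclose : ∀ m x, n ≤ m → |ψ m x - ∫ ω, h (pastAt t ω) ∂μ| ≤ S m := fun m x hnm => by
    have hd : ∀ x x', ψ m x - ψ m x' ≤ S m := fun x x' => by
      refine (hosc m x x').trans (le_of_eq ?_)
      rw [add_eq_left]
      refine Finset.sum_eq_zero fun k _ => ?_
      rw [hδn _ (by omega), ite_self]
    rw [← hmean m, abs_le]
    have h1 := integral_mono (μ := μ) (hψint m (t - m)) (integrable_const (ψ m x + S m)) fun ω => by
      have := hd (pastAt (t - m) ω) x
      simp only
      linarith
    have h2 := integral_mono (μ := μ) (integrable_const (ψ m x - S m)) (hψint m (t - m)) fun ω => by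
      have := hd x (pastAt (t - m) ω)
      simp only
      linarith
    simp only [integral_const, probReal_univ, one_smul] at h1 h2
    constructor <;> linarith
  have hS0 : Filter.Tendsto S Filter.atTop (𝓝 0) := by
    have h1 : Filter.Tendsto (fun m => ∑ i ∈ Finset.range n, δ i * p (m - i)) Filter.atTop
        (𝓝 (∑ i ∈ Finset.range n, δ i * 0)) := tendsto_finsetSum _ fun i _ =>
      ((g.tendsto_resetProb hg).comp (Filter.tendsto_sub_atTop_nat i)).const_mul _
    simp only [mul_zero, Finset.sum_const_zero] at h1
    refine h1.congr' ?_
    filter_upwards [Filter.eventually_ge_atTop n] with m hm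
    refine Finset.sum_subset (Finset.range_mono hm) fun i _ hi => ?_
    rw [hδn i (by simpa using hi), zero_mul]
  have hlim : Filter.Tendsto (fun m =>
      Real.exp (θ ^ 2 / 8 * (g.Gam⁻¹ ^ 2 * ∑ k ∈ Finset.range n, δ k ^ 2)) *
        Real.exp (θ * ∫ ω, h (pastAt t ω) ∂μ + |θ| * S m)) Filter.atTop
      (𝓝 (Real.exp (θ ^ 2 / 8 * (g.Gam⁻¹ ^ 2 * ∑ k ∈ Finset.range n, δ k ^ 2)) *
        Real.exp (θ * ∫ ω, h (pastAt t ω) ∂μ + |θ| * 0))) :=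
    ((Real.continuous_exp.tendsto _).comp ((hS0.const_mul _).const_add _)).const_mul _
  rw [mul_zero, add_zero] at hlim
  -- The left side does not depend on `m`, so the error `|θ| * S m` can be sent to zero.
  refine ge_of_tendsto hlim ?_
  filter_upwards [Filter.eventually_ge_atTop n] with m hnm
  refine (hiter m).trans (mul_le_mul ?_ ?_ (integral_nonneg fun _ => (Real.exp_pos _).le)
    (Real.exp_pos _).le)
  · refine Real.exp_le_exp.2 (mul_le_mul_of_nonneg_left ?_ (by positivity))
    refine (sum_sq_convolution_le (fun l => resetProb_nonneg g.variation_mem_Icc l 0)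
      (sum_resetProb_le g.variation_mem_Icc hg g.Gam_le_prod) m).trans (le_of_eq ?_)
    congr 1
    refine (Finset.sum_subset (Finset.range_mono hnm) fun i _ hi => ?_).symm
    rw [hδn i (by simpa using hi), sq, zero_mul]
  · have h1 := integral_mono (hint m (t - m)) (integrable_const
      (Real.exp (θ * ∫ ω, h (pastAt t ω) ∂μ + |θ| * S m))) fun ω => by
        refine Real.exp_le_exp.2 ?_
        have h2 := (le_abs_self _).trans (abs_mul θ
          (ψ m (pastAt (t - m) ω) - ∫ ω, h (pastAt t ω) ∂μ)).le
        have h3 := mul_le_mul_of_nonneg_left (hclose m (pastAt (t - m) ω) hnm) (abs_nonneg θ)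
        linarith
    simpa only [integral_const, probReal_univ, one_smul] using h1

end GKernel

/-! ### Oscillations and functions of finitely many symbols. -/

section Oscillation

variable {n : ℕ} {f : (Fin (n + 1) → A) → ℝ}

theorem osc_nonneg (f : (Fin (n + 1) → A) → ℝ) (j : Fin (n + 1)) : 0 ≤ osc f j :=
  Real.sSup_nonneg (by rintro r ⟨ω, a, b, rfl⟩; exact abs_nonneg _)

-- Change the coordinates from `y` to `x` one at a time, paying only where they differ.
open Classical in
theorem FiniteOsc.sub_le (hf : FiniteOsc f) (x y : Fin (n + 1) → A) :
    f x - f y ≤ ∑ j, if x j = y j then 0 else osc f j := by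
  suffices H : ∀ s : Finset (Fin (n + 1)),
      f (s.piecewise x y) - f y ≤ ∑ j ∈ s, if x j = y j then 0 else osc f j by
    simpa using H Finset.univ
  intro s
  induction s using Finset.induction_on with
  | empty => simp
  | insert j s hj ih =>
    rw [Finset.sum_insert hj, Finset.piecewise_insert]
    set w := s.piecewise x y
    have hw : w = Function.update w j (y j) := by
      rw [← Finset.piecewise_eq_of_notMem s x y hj, Function.update_eq_self]
    have hstep : f (Function.update w j (x j)) - f w ≤ if x j = y j then 0 else osc f j := by
      split_ifs with h
      · rw [h, ← hw, sub_self]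
      · calc _ = f (Function.update w j (x j)) - f (Function.update w j (y j)) := by rw [← hw]
          _ ≤ _ := (le_abs_self _).trans (le_csSup (hf j) ⟨w, x j, y j, rfl⟩)
    linarith

theorem FiniteOsc.exists_bound [Nonempty A] (hf : FiniteOsc f) : ∃ K, ∀ x, |f x| ≤ K := by
  classical
  let y : Fin (n + 1) → A := fun _ => Classical.arbitrary A
  have hle : ∀ u v, f u - f v ≤ ∑ j, osc f j := fun u v =>
    (hf.sub_le u v).trans (Finset.sum_le_sum fun j _ => by
      split_ifs; exacts [osc_nonneg f j, le_rfl])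
  refine ⟨|f y| + ∑ j, osc f j, fun x => ?_⟩
  have h1 := hle x y
  have h2 := hle y x
  have h3 := abs_le.1 (le_refl |f y|)
  exact abs_le.2 ⟨by linarith, by linarith⟩

end Oscillation

section Concentration

variable [Countable A] [MeasurableSpace A] [DiscreteMeasurableSpace A] {g : GKernel A}
  {μ : Measure (ℤ → A)} [IsProbabilityMeasure μ] {n : ℕ} {f : (Fin (n + 1) → A) → ℝ}

theorem measurable_cyl (f : (Fin (n + 1) → A) → ℝ) : Measurable (cyl f) :=
  (measurable_of_countable f).comp (by fun_prop)

theorem integral_exp_cyl_le [Nonempty A] (hg : 0 < g.Gam) (hcomp : Compatible μ g)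
    (hf : FiniteOsc f) (θ : ℝ) :
    ∫ ω, Real.exp (θ * cyl f ω) ∂μ ≤
      Real.exp (θ ^ 2 / 8 * (g.Gam⁻¹ ^ 2 * oscNormSq f)) * Real.exp (θ * ∫ ω, cyl f ω ∂μ) := by
  classical
  obtain ⟨K, hK⟩ := hf.exists_bound
  -- Seen from time `n + 1`, coordinate `k` of the past is `ω (n - k)`, hence the reversal of
  -- indices.
  let e : Past A → Fin (n + 1) → A := fun x i => x (i.rev : ℕ)
  let δ : ℕ → ℝ := fun k => if hk : k < n + 1 then osc f (Fin.rev ⟨k, hk⟩) else 0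
  have he : ∀ ω, cyl f ω = f (e (pastAt (n + 1 : ℕ) ω)) := fun ω => by
    simp only [cyl, e, pastAt]
    congr 1
    funext i
    congr 1
    have := i.is_lt
    rw [Fin.val_rev]
    omega
  have hδ : ∀ i : Fin (n + 1), δ i = osc f i.rev := fun i => dif_pos i.is_lt
  have hsum : ∑ k ∈ Finset.range (n + 1), δ k ^ 2 = oscNormSq f := by
    rw [Finset.sum_range]
    simp only [hδ, oscNormSq]
    exact Equiv.sum_comp Fin.revPerm fun j => osc f j ^ 2
  have key := g.integral_exp_le hg hcomp (h := fun x => f (e x)) (δ := δ) (n := n + 1)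
    ((measurable_of_countable f).comp (by fun_prop)) (fun x => hK _)
    (fun k => by dsimp only [δ]; split_ifs; exacts [osc_nonneg _ _, le_rfl])
    (fun k hk => dif_neg (by omega)) (fun x x' => ?_) θ (n + 1 : ℕ)
  · simpa only [hsum, ← he] using key
  · refine (hf.sub_le _ _).trans (le_of_eq ?_)
    rw [Finset.sum_range, ← Equiv.sum_comp Fin.revPerm]
    refine Finset.sum_congr rfl fun i _ => ?_
    simp only [hδ, e, Fin.revPerm_apply, Fin.rev_rev]

/-- The sub-Gaussian bound reads `exp (c θ² / 2)`, so the factor `1/8` becomes `c = Γ⁻² ‖δ(f)‖₂² /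
4`. -/
theorem hasSubgaussianMGF_cyl [Nonempty A] (hg : 0 < g.Gam) (hcomp : Compatible μ g)
    (hf : FiniteOsc f) {c : NNReal} (hc : (c : ℝ) = g.Gam⁻¹ ^ 2 * oscNormSq f / 4) :
    ProbabilityTheory.HasSubgaussianMGF (fun ω => cyl f ω - ∫ η, cyl f η ∂μ) c μ where
  integrable_exp_mul θ := by
    obtain ⟨K, hK⟩ := hf.exists_bound
    refine ProbabilityTheory.integrable_exp_mul_of_mem_Icc (a := -K - ∫ η, cyl f η ∂μ)
      (b := K - ∫ η, cyl f η ∂μ) ((measurable_cyl f).sub_const _).aemeasurable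
      (Filter.Eventually.of_forall fun ω => ?_)
    have := abs_le.1 (hK fun i => ω (i : ℕ))
    exact ⟨sub_le_sub_right this.1 _, sub_le_sub_right this.2 _⟩
  mgf_le θ := by
    have h := integral_exp_cyl_le hg hcomp hf θ
    unfold ProbabilityTheory.mgf
    simp_rw [mul_sub, Real.exp_sub, integral_div]
    rw [div_le_iff₀ (Real.exp_pos _)]
    refine h.trans (le_of_eq ?_)
    rw [hc]
    congr 2
    ring

end Concentration

end SCUM

/-! ### The concentration theorem. -/

theorem mainTheorem4 {A : Type*} [Countable A] [MeasurableSpace A] [DiscreteMeasurableSpace A]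
    (g : SCUM.GKernel A) (hg : 0 < g.Gam)
    (μ : Measure (ℤ → A)) [IsProbabilityMeasure μ]
    (hinv : MeasurePreserving SCUM.shift μ μ) (hcomp : SCUM.Compatible μ g) :
    SCUM.GCBWith μ (g.Gam ^ (-2 : ℤ) / 8) ∧
    ∀ (n : ℕ) (f : (Fin (n + 1) → A) → ℝ), SCUM.FiniteOsc f →
      (∀ θ : ℝ,
        Integrable (fun ω => Real.exp (θ * (SCUM.cyl f ω - ∫ η, SCUM.cyl f η ∂μ))) μ ∧
        ∫ ω, Real.exp (θ * (SCUM.cyl f ω - ∫ η, SCUM.cyl f η ∂μ)) ∂μ ≤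
          Real.exp (θ ^ 2 * g.Gam ^ (-2 : ℤ) / 8 * SCUM.oscNormSq f)) ∧
      (∀ u : ℝ, 0 < u →
        μ.real {ω | u < |SCUM.cyl f ω - ∫ η, SCUM.cyl f η ∂μ|} ≤
          2 * Real.exp (-(2 * u ^ 2 / (g.Gam ^ (-2 : ℤ) * SCUM.oscNormSq f))) ∧
        -- the convention `exp (-∞) = 0` when `f` has no oscillation
        (SCUM.oscNormSq f = 0 →
          μ.real {ω | u < |SCUM.cyl f ω - ∫ η, SCUM.cyl f η ∂μ|} = 0)) := by
  have hne : Nonempty A := (nonempty_of_isProbabilityMeasure μ).map fun ω => ω 0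
  have hpow : g.Gam ^ (-2 : ℤ) = g.Gam⁻¹ ^ 2 := by
    rw [zpow_neg, inv_pow]; rfl
  have hosc0 : ∀ {n : ℕ} (f : (Fin (n + 1) → A) → ℝ), 0 ≤ SCUM.oscNormSq f := fun f =>
    Finset.sum_nonneg fun _ _ => sq_nonneg _
  have hsub : ∀ {n : ℕ} {f : (Fin (n + 1) → A) → ℝ}, SCUM.FiniteOsc f →
      ProbabilityTheory.HasSubgaussianMGF (fun ω => SCUM.cyl f ω - ∫ η, SCUM.cyl f η ∂μ)
        (Real.toNNReal (g.Gam⁻¹ ^ 2 * SCUM.oscNormSq f / 4)) μ := fun {n f} hf =>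
    SCUM.hasSubgaussianMGF_cyl hg hcomp hf (Real.coe_toNNReal _ (by have := hosc0 f; positivity))
  have hcoe : ∀ {n : ℕ} (f : (Fin (n + 1) → A) → ℝ),
      (Real.toNNReal (g.Gam⁻¹ ^ 2 * SCUM.oscNormSq f / 4) : ℝ) =
        g.Gam⁻¹ ^ 2 * SCUM.oscNormSq f / 4 := fun f =>
    Real.coe_toNNReal _ (by have := hosc0 f; positivity)
  have hmgf : ∀ (n : ℕ) (f : (Fin (n + 1) → A) → ℝ), SCUM.FiniteOsc f → ∀ θ : ℝ,
      Integrable (fun ω => Real.exp (θ * (SCUM.cyl f ω - ∫ η, SCUM.cyl f η ∂μ))) μ ∧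
      ∫ ω, Real.exp (θ * (SCUM.cyl f ω - ∫ η, SCUM.cyl f η ∂μ)) ∂μ ≤
        Real.exp (θ ^ 2 * g.Gam ^ (-2 : ℤ) / 8 * SCUM.oscNormSq f) := fun n f hf θ => by
    refine ⟨(hsub hf).integrable_exp_mul θ, ((hsub hf).mgf_le θ).trans (le_of_eq ?_)⟩
    rw [hcoe, hpow]
    congr 1
    ring
  refine ⟨⟨by positivity, fun n f hf => ?_⟩, fun n f hf => ⟨hmgf n f hf, fun u hu => ⟨?_, ?_⟩⟩⟩
  · obtain ⟨K, hK⟩ := hf.exists_bound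
    have h := hmgf n f hf 1
    simp only [one_mul, one_pow] at h
    exact ⟨Integrable.of_bound (SCUM.measurable_cyl f).aestronglyMeasurable K
      (Filter.Eventually.of_forall fun ω => hK _), h⟩
  · have h1 := (hsub hf).measure_ge_le hu.le
    have h2 := (hsub hf).neg.measure_ge_le hu.le
    have hexp : -u ^ 2 / (2 * (Real.toNNReal (g.Gam⁻¹ ^ 2 * SCUM.oscNormSq f / 4) : ℝ)) =
        -(2 * u ^ 2 / (g.Gam ^ (-2 : ℤ) * SCUM.oscNormSq f)) := by
      rw [hcoe, hpow, show 2 * (g.Gam⁻¹ ^ 2 * SCUM.oscNormSq f / 4) =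
        (g.Gam⁻¹ ^ 2 * SCUM.oscNormSq f) / 2 by ring, div_div_eq_mul_div]
      ring
    rw [hexp] at h1 h2
    rw [two_mul]
    refine (measureReal_mono ?_).trans ((measureReal_union_le _ _).trans (add_le_add h1 h2))
    intro ω hω
    rcases lt_abs.1 (show u < |_| from hω) with h | h
    · exact Or.inl h.le
    · exact Or.inr h.le
  -- Division by zero makes the general tail bound equal to `2` here, so this case is separate: `f`
  -- is constant and the deviation vanishes identically.
  · intro h0
    have hj : ∀ j, SCUM.osc f j = 0 := fun j => by
      have := (Finset.sum_eq_zero_iff_of_nonneg fun j _ => sq_nonneg (SCUM.osc f j)).1 h0 j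
        (Finset.mem_univ j)
      exact pow_eq_zero_iff two_ne_zero |>.1 this
    have hconst : ∀ x y, f x = f y := fun x y => by
      classical
      have h1 := hf.sub_le x y
      have h2 := hf.sub_le y x
      simp only [hj, ite_self, Finset.sum_const_zero] at h1 h2
      linarith
    have hzero : ∀ ω, SCUM.cyl f ω - ∫ η, SCUM.cyl f η ∂μ = 0 := fun ω => by
      have : ∀ η, SCUM.cyl f η = SCUM.cyl f ω := fun η => hconst _ _
      simp [this]
    simp [hzero, hu.le.not_gt]
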